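/- **Setting (logic of co-valuations).** For a relation $R\subseteq X\times Y$ let $[x]_R=\{y: xRy\}$ and $\pi_R=\{(x,y)\in R : x'Ry\Rightarrow x'=x\}$. $\mathrm{Val}(X,Y)$ is the set of relations $R\subseteq X\times Y$ such that every $x\in X$ is $\pi_R$-related to some $y$ and every $y\in Y$ is $R$-related from some $x$ (that is, $\{[x]_R\}_{x\in X}$ is a minimal cover of $Y$, indexed injectively); its elements are *co-valuations on $Y$ in $X$*. If $w\in\mathrm{Val}(Y,M)$ and $g\in\mathrm{Val}(X,Y)$, then $C_g(w)=g\circ w\in\mathrm{Val}(X,M)$ is a *consolidation* of $w$, and $w$ is a *fragmentation* of $C_g(w)$. A *context* is a finite set of variables taken from a countably infinite set with a distinguished variable $*$. Let $L$ be a relational signature. Formulas in context $X$ are generated by $\bot$, $R(\bar x)$ with $R\in L$ and $\bar x$ a tuple in $X$, $\neg\phi(X)$, $\phi(X)\wedge\psi(X)$, and $\exists^{\mathrm{fr}}_{g}\phi(Y)$ with $g\in\mathrm{Val}(X,Y)$. A *type* in context $X$ is a set of formulas in context $X$; it is *complete* if it contains $\phi$ or $\neg\phi$ for every such $\phi$.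 Sentences are formulas in context $\{*\}$, and a *theory* is a set of sentences. A *proto-structure* $(M,V)$ is a set $M$ with an interpretation of $L$ and a family $V$ of (*admissible*) co-valuations on $M$ in contexts that is closed under consolidations by contexts; $V^X=V\cap\mathrm{Val}(X,M)$. For $v\in V^X$ put $M\models_v R(\bar x)$ iff $R^M(\bar a)$ for some $\bar a$ with $a_k\in[x_k]_v$ for all $k$; $M\models_v\exists^{\mathrm{fr}}_g\phi$ iff $v=C_g(w)$ and $M\models_w\phi$ for some $w\in V$; and treat $\bot,\neg,\wedge$ as usual. It is a *structure* if (I) any two members of $V$ have a common fragmentation in $V$, and (II) whenever $v\in V^X$ and $M\models_v R(\bar x)$, there are $w\in V^Y$, a tuple $\bar y$ in $Y$, and $\bar a$ with $R^M(\bar a)$, $(y_k,a_k)\in\pi_w$ and $[y_k]_w\subseteq[x_k]_v$ for all $k$. It *realizes* a type $p(X)$ if some $v\in V^X$ satisfies all formulas of $p$. A *model* of a theory $T$ is a structure realizing $T$ (so it is nonempty, and $\{*\}\times M$ is admissible). A *compact $\omega$-structure* is a structure such that (a) there is a compact $T_1$ topology on $M$ in which all sets $[x]_v$ ($v\in V$)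 are open, every open cover of $M$ is refined by $\{[x]_v\}_x$ for some $v\in V$, and all $R^M$ are closed; and (b) there are $v_0,v_1,\dots\in V$, each $v_i$ a consolidation of $v_{i+1}$, such that every member of $V$ is a consolidation of some $v_i$. For each $n\in\mathbb N$ fix a context $X_n$ of size $n$. $S_n(T)$ is the set of complete types in context $X_n$ realized by models of $T$, with the topology generated by the sets $[\phi]=\{p:\phi\in p\}$. A type $p(X)$ of $T$ is *isolated* if there is a formula $\phi(X)$, realized in some model of $T$, such that for all models $(M,V)$ of $T$ and $v\in V^X$, $M\models_v\phi$ implies $M\models_v\psi$ for every $\psi\in p$. An *atomic model* of $T$ is a compact $\omega$-structure that is a model of $T$ and such that every complete type, in any context, that it realizes is isolated. **Theorem.** Let $L$ be a countable relational signature and let $T$ be a theory in $L$ that has a model. 1. If the isolated types are dense in $S_n(T)$ for every $n\in\mathbb N$, then $T$ has an atomic model. 2. If moreover $T$ is complete (every sentence holds in all models of $T$, or its negation does), then $T$ has an atomic model if and only if the isolated types are dense in $S_n(T)$ for every $n\in\mathbb N$. -/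

import Mathlib

universe u v w

namespace CovLogic

/-! ### Co-bijective relations -/

/-- The relation `π_R`: the pairs `(x, y)` in `R` such that `x` is the only element related to `y`. -/
def uniquePart {X : Type*} {Y : Type*} (R : X → Y → Prop) (x : X) (y : Y) : Prop :=
  R x y ∧ ∀ x', R x' y → x = x'

/-- `π_R` is the largest `R' ⊆ R` such that `x R' y` and `x' R y` imply `x = x'`. -/
theorem uniquePart_largest {X : Type*} {Y : Type*} (R R' : X → Y → Prop)
    (hsub : ∀ x y, R' x y → R x y) (h : ∀ x x' y, R' x y → R x' y → x = x') (x : X) (y : Y) :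
    R' x y → uniquePart R x y :=
  fun hxy => ⟨hsub x y hxy, fun x' hx' => h x x' y hxy hx'⟩

/-- `Val(X, Y)`: co-bijective relations between `X` and `Y`, i.e. co-valuations on `Y` in `X`. -/
@[ext]
structure Val (X : Type*) (Y : Type*) where
  /-- the underlying relation -/
  rel : X → Y → Prop
  /-- co-injectivity: `π_R` is surjective -/
  coinjective : ∀ x, ∃ y, uniquePart rel x y
  /-- co-surjectivity: every element of `Y` is covered -/
  cosurjective : ∀ y, ∃ x, rel x y

/-- The set `[x]_v`. -/
def Val.cell {X : Type*} {Y : Type*} (v : Val X Y) (x : X) : Set Y := {a | v.rel x a}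

/-- `C_g(w) = g ∘ w`, the consolidation of `w` with pattern `g`. -/
def Val.consolidation {X : Type*} {Y : Type*} {M : Type*} (g : Val X Y) (w : Val Y M) :
    Val X M where
  rel := Relation.Comp g.rel w.rel
  coinjective := by
    intro x
    obtain ⟨y, hxy, hy⟩ := g.coinjective x
    obtain ⟨a, hya, ha⟩ := w.coinjective y
    refine ⟨a, ⟨y, hxy, hya⟩, ?_⟩
    rintro x' ⟨y', hx'y', hy'a⟩
    obtain rfl := ha y' hy'a
    exact hy x' hx'y'
  cosurjective := by
    intro a
    obtain ⟨y, hy⟩ := w.cosurjective a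
    obtain ⟨x, hx⟩ := g.cosurjective y
    exact ⟨x, y, hx, hy⟩

/-- `v` is a consolidation of `w`, equivalently `w` is a fragmentation of `v`. -/
def Val.IsConsolidation {X : Type*} {Y : Type*} {M : Type*} (v : Val X M) (w : Val Y M) : Prop :=
  ∃ g : Val X Y, v = g.consolidation w

/-! ### Syntax -/

/-- Contexts are finite sets of variables; the variables are the natural numbers. -/
abbrev Context : Type := Finset ℕ

/-- The context `{*}`, where `*` is the variable `0`. -/
def starContext : Context := {0}

/-- Formulas in a context, over the relation symbols of `L`. -/
inductive Formula (L : FirstOrder.Language.{u, v}) : Context → Type v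
  | bot {X : Context} : Formula L X
  | rel {X : Context} {m : ℕ} (R : L.Relations m) (x : Fin m → X) : Formula L X
  | neg {X : Context} (φ : Formula L X) : Formula L X
  | and {X : Context} (φ ψ : Formula L X) : Formula L X
  | exFr {X Y : Context} (g : Val X Y) (φ : Formula L Y) : Formula L X

/-- A type `p(X)` is a set of formulas in context `X`. -/
abbrev PType (L : FirstOrder.Language.{u, v}) (X : Context) : Type v := Set (Formula L X)

/-- A theory is a set of sentences, i.e. of formulas in the context `{*}`. -/
abbrev Theory (L : FirstOrder.Language.{u, v}) : Type v := PType L starContext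

/-- `p(X)` contains every formula `φ(X)` or its negation. -/
def PType.IsComplete {L : FirstOrder.Language.{u, v}} {X : Context} (p : PType L X) : Prop :=
  ∀ φ : Formula L X, φ ∈ p ∨ φ.neg ∈ p

/-! ### Structures -/

/-- Proto-structures `(M, V)`; `adm X` is `V^X`, the set of admissible co-valuations in `X`. -/
structure ProtoStructure (L : FirstOrder.Language.{u, v}) where
  /-- the universe -/
  carrier : Type w
  /-- the relations -/
  str : L.Structure carrier
  /-- the admissible co-valuations in a given context -/
  adm : (X : Context) → Set (Val X carrier)
  /-- admissible co-valuations are closed under consolidations by contexts -/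
  consolidation_mem : ∀ {X Y : Context} (g : Val X Y), ∀ w ∈ adm Y, g.consolidation w ∈ adm X

namespace ProtoStructure

attribute [instance] ProtoStructure.str

variable {L : FirstOrder.Language.{u, v}} (M : ProtoStructure.{u, v, w} L)

/-- The satisfaction relation `M ⊨_v φ`. -/
def Sat : {X : Context} → Val X M.carrier → Formula L X → Prop
  | _, _, .bot => False
  | _, v, .rel R x =>
      ∃ a : Fin _ → M.carrier, (∀ k, a k ∈ v.cell (x k)) ∧ FirstOrder.Language.Structure.RelMap R a
  | _, v, .neg φ => ¬ Sat v φ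
  | _, v, .and φ ψ => Sat v φ ∧ Sat v ψ
  | _, v, .exFr (Y := Y) g φ => ∃ w ∈ M.adm Y, v = g.consolidation w ∧ Sat w φ

/-- The type `p(X)` is realized in `M` by some admissible co-valuation. -/
def Realizes {X : Context} (p : PType L X) : Prop :=
  ∃ v ∈ M.adm X, ∀ φ ∈ p, M.Sat v φ

/-- The axioms of structures. -/
structure IsStructure : Prop where
  /-- admissible co-valuations are directed under fragmentation -/
  directed : ∀ {X Y : Context}, ∀ u ∈ M.adm X, ∀ v ∈ M.adm Y,
    ∃ Z : Context, ∃ w ∈ M.adm Z, u.IsConsolidation w ∧ v.IsConsolidation w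
  /-- witnesses of relations can be found in the uniquely covered parts of finer cells -/
  rel_witness : ∀ {m : ℕ} (R : L.Relations m) {X : Context}, ∀ v ∈ M.adm X, ∀ x : Fin m → X,
    M.Sat v (.rel R x) → ∃ Y : Context, ∃ w ∈ M.adm Y, ∃ (y : Fin m → Y) (a : Fin m → M.carrier),
      (∀ k, uniquePart w.rel (y k) (a k)) ∧ (∀ k, w.cell (y k) ⊆ v.cell (x k)) ∧
      FirstOrder.Language.Structure.RelMap R a

/-- There is a core: an `ω`-chain of admissible co-valuations that generates all of them. -/
def IsOmega : Prop :=
  ∃ (X : ℕ → Context) (c : (i : ℕ) → Val (X i) M.carrier),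
    (∀ i, c i ∈ M.adm (X i)) ∧ (∀ i, (c i).IsConsolidation (c (i + 1))) ∧
    ∀ (Y : Context), ∀ u ∈ M.adm Y, ∃ i, u.IsConsolidation (c i)

/-- There is a compact `T₁` topology for which the admissible co-valuations are open covers that
refine every open cover, and in which all relations are closed. -/
def IsCompact : Prop :=
  ∃ _ : TopologicalSpace M.carrier, CompactSpace M.carrier ∧ T1Space M.carrier ∧
    (∀ (X : Context), ∀ v ∈ M.adm X, ∀ x, IsOpen (v.cell x)) ∧
    (∀ U : Set (Set M.carrier), (∀ s ∈ U, IsOpen s) → ⋃₀ U = Set.univ →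
      ∃ X : Context, ∃ v ∈ M.adm X, ∀ x, ∃ s ∈ U, v.cell x ⊆ s) ∧
    ∀ {m : ℕ} (R : L.Relations m),
      IsClosed {a : Fin m → M.carrier | FirstOrder.Language.Structure.RelMap R a}

/-- Compact `ω`-structures. -/
def IsCompactOmega : Prop := M.IsStructure ∧ M.IsCompact ∧ M.IsOmega

/-- `M` is a model of `T`. The co-valuation `{*} × M` is the only one on `M` in the context `{*}`;
as it has to be admissible, a model has a nonempty universe and some admissible co-valuation. -/
def IsModel (T : Theory L) : Prop := M.IsStructure ∧ M.Realizes T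

end ProtoStructure

/-! ### Theories and types -/

namespace Theory

variable {L : FirstOrder.Language.{u, v}}

/-- `T` has a model. -/
def IsConsistent (T : Theory L) : Prop :=
  ∃ M : ProtoStructure.{u, v, w} L, M.IsModel T

/-- `T` decides every sentence: the sentence holds in all models of `T`, or its negation does. -/
def Decides (T : Theory L) : Prop :=
  ∀ σ : Formula L starContext,
    (∀ M : ProtoStructure.{u, v, w} L, M.IsModel T → M.Realizes {σ}) ∨
    (∀ M : ProtoStructure.{u, v, w} L, M.IsModel T → M.Realizes {σ.neg})

/-- The space of complete types in context `X` that are realized by models of `T`. If `X` has `n`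
elements, this is `S_n(T)`. -/
def TypeSpace (T : Theory L) (X : Context) : Type v :=
  {p : PType L X // p.IsComplete ∧ ∃ M : ProtoStructure.{u, v, w} L, M.IsModel T ∧ M.Realizes p}

/-- The basic open set `[φ]`. -/
def basicOpen (T : Theory L) {X : Context} (φ : Formula L X) :
    Set (TypeSpace.{u, v, w} T X) :=
  {p | φ ∈ p.1}

/-- The logic topology. -/
instance (T : Theory L) (X : Context) : TopologicalSpace (TypeSpace.{u, v, w} T X) :=
  TopologicalSpace.generateFrom {U | ∃ φ : Formula L X, U = basicOpen.{u, v, w} T φ}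

/-- A type of `T` is isolated if some formula that is consistent with `T` implies it modulo `T`. -/
def IsIsolated (T : Theory L) {X : Context} (p : PType L X) : Prop :=
  ∃ φ : Formula L X,
    (∃ M : ProtoStructure.{u, v, w} L, M.IsModel T ∧ M.Realizes {φ}) ∧
    ∀ M : ProtoStructure.{u, v, w} L, M.IsModel T → ∀ v ∈ M.adm X, M.Sat v φ →
      ∀ ψ ∈ p, M.Sat v ψ

/-- Isolated types are dense in the space of complete types in context `X`. -/
def IsolatedDense (T : Theory L) (X : Context) : Prop :=
  Dense {p : TypeSpace.{u, v, w} T X | IsIsolated.{u, v, w} T p.1}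

/-- `M` is an atomic model of `T`: a compact `ω`-structure that is a model of `T` and realizes only
isolated types of `T`. -/
def IsAtomicModel (T : Theory L) (M : ProtoStructure.{u, v, w} L) : Prop :=
  M.IsCompactOmega ∧ M.IsModel T ∧
    ∀ (X : Context) (p : TypeSpace.{u, v, w} T X), M.Realizes p.1 → IsIsolated.{u, v, w} T p.1

end Theory

end CovLogic

/-! For the first part, an omitting-types construction is carried out inside a single model `N`.
Density enters in `exists_isIsolated_fragmentation`. Suppose the type of `v` is isolated by `χ` and
`∃fr_h φ` holds at `v`. Then `φ`, together with the truth of `χ` after consolidation by `h`, belongs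
to an isolated type realized in some model. If `ξ` isolates that type, then `∃fr_h ξ` belongs to the
type of `v`, so the isolated type is already realized in `N` by a fragmentation of `v`. There are
only countably many formulas, so iteration gives a chain `c` of co-valuations with isolated types in
which every `∃fr` true at a consolidation of a member has a witness of the same kind
(`exists_generic_chain`), a Tarski–Vaught condition.

The points of the atomic model are the minimal selectors of `c`. They form a compact `T₁` space to
which the consolidations of the `c i` lift, and the lift preserves truth
(`spectrumStructure_sat_lift`). So every realized type is that of a consolidation of some `c i`,
which is isolated by `IsIsolated.consolidation`.

Two facts about definability support this. Truth at a consolidation is expressible at the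
fragmentation (`isDefinable_sat_consolidation`), because common fragmentations of bounded size
suffice. The point witnesses in axiom (II), which formulas cannot mention, are traded for the
definable property `PrivatelyRelated`, from which points of the spectrum are recovered by an
ultrafilter limit.

For the converse in the second part, realizability of a formula is itself a sentence. A complete
theory decides it, so an atomic model realizes every consistent formula, and does so in an isolated
type. -/

namespace CovLogic

/-! ### Algebra of co-valuations and consolidations -/

namespace Val

variable {X Y Z A : Type*}

theorem consolidation_assoc (g : Val X Y) (h : Val Y Z) (w : Val Z A) :
    (g.consolidation h).consolidation w = g.consolidation (h.consolidation w) :=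
  Val.ext Relation.comp_assoc

/-- A point covered by the cell of `y` alone detects `y`. Hence the pattern `g` can be read off from
inclusions between cells, and equations between consolidations of one `w` reduce to equations
between patterns. -/
theorem cell_subset_consolidation_cell {g : Val X Y} {w : Val Y A} {x : X} {y : Y} :
    w.cell y ⊆ (g.consolidation w).cell x ↔ g.rel x y := by
  constructor
  · intro h
    obtain ⟨a, hya, ha⟩ := w.coinjective y
    obtain ⟨y', hxy', hy'⟩ := h hya
    rwa [ha y' hy']
  · exact fun h a ha => ⟨y, h, ha⟩

theorem consolidation_left_injective (w : Val Y A) :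
    Function.Injective fun g : Val X Y => g.consolidation w := by
  intro g g' h
  ext x y
  rw [← cell_subset_consolidation_cell (w := w), ← cell_subset_consolidation_cell (w := w)]
  exact iff_of_eq (congrArg (fun v : Val X A => w.cell y ⊆ v.cell x) h)

theorem consolidation_cell_subset_iff {g : Val X Z} {h : Val Y Z} {w : Val Z A} {x : X} {y : Y} :
    (h.consolidation w).cell y ⊆ (g.consolidation w).cell x ↔ ∀ z, h.rel y z → g.rel x z := by
  constructor
  · intro H z hz
    exact cell_subset_consolidation_cell.1 ((cell_subset_consolidation_cell.2 hz).trans H)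
  · rintro H a ⟨z, hz, hza⟩
    exact ⟨z, H z hz, hza⟩

theorem IsConsolidation.trans {W : Type*} {u : Val X A} {v : Val Y A} {w : Val W A}
    (huv : u.IsConsolidation v) (hvw : v.IsConsolidation w) : u.IsConsolidation w := by
  obtain ⟨g, rfl⟩ := huv
  obtain ⟨h, rfl⟩ := hvw
  exact ⟨g.consolidation h, (consolidation_assoc ..).symm⟩

/-- The co-valuation with pairwise disjoint cells given by a surjective function. -/
def ofSurjective (q : Y → X) (hq : Function.Surjective q) : Val X Y where
  rel x y := q y = x
  coinjective x := (hq x).imp fun _ hy => ⟨hy, fun _ hx' => hy.symm.trans hx'⟩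
  cosurjective y := ⟨q y, rfl⟩

theorem ofSurjective_consolidation_ofSurjective (e : X ≃ Y) (w : Val X A) :
    (ofSurjective e.symm e.symm.surjective).consolidation
      ((ofSurjective e e.surjective).consolidation w) = w := by
  ext x a
  constructor
  · rintro ⟨_, rfl, _, rfl, h⟩
    simpa using h
  · exact fun h => ⟨e x, by simp [ofSurjective], x, rfl, h⟩

theorem refl_isConsolidation (v : Val X A) : v.IsConsolidation v :=
  ⟨_, (ofSurjective_consolidation_ofSurjective (Equiv.refl X) v).symm.trans
    (consolidation_assoc ..).symm⟩

/-- A co-valuation that is constant on the fibres of a surjective function descends along it. -/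
def descend (g : Val X Y) (q : Y → Z) (hq : Function.Surjective q)
    (hg : ∀ y y', q y = q y' → ∀ x, g.rel x y → g.rel x y') : Val X Z where
  rel x z := ∃ y, q y = z ∧ g.rel x y
  coinjective x := by
    obtain ⟨y, hxy, hy⟩ := g.coinjective x
    refine ⟨q y, ⟨y, rfl, hxy⟩, ?_⟩
    rintro x' ⟨y', hy', hx'⟩
    exact hy x' (hg _ _ hy' _ hx')
  cosurjective z := by
    obtain ⟨y, rfl⟩ := hq z
    obtain ⟨x, hx⟩ := g.cosurjective y
    exact ⟨x, y, rfl, hx⟩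

theorem descend_consolidation (g : Val X Y) (q : Y → Z) (hq : Function.Surjective q)
    (hg : ∀ y y', q y = q y' → ∀ x, g.rel x y → g.rel x y') :
    (g.descend q hq hg).consolidation (ofSurjective q hq) = g := by
  ext x y
  constructor
  · rintro ⟨_, ⟨y', hy', hxy'⟩, rfl⟩
    exact hg _ _ hy' _ hxy'
  · exact fun h => ⟨q y, ⟨y, rfl, h⟩, rfl⟩

theorem descend_consolidation_assoc (g : Val X Y) (q : Y → Z) (hq : Function.Surjective q)
    (hg : ∀ y y', q y = q y' → ∀ x, g.rel x y → g.rel x y') (w : Val Y A) :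
    (g.descend q hq hg).consolidation ((ofSurjective q hq).consolidation w) =
      g.consolidation w := by
  rw [← consolidation_assoc, descend_consolidation]

instance [Finite X] [Finite Y] : Finite (Val X Y) :=
  Finite.of_injective Val.rel fun _ _ h => Val.ext h

/-- The total relation. -/
def total (X Y : Type*) [Unique X] [Nonempty Y] : Val X Y where
  rel _ _ := True
  coinjective _ := ⟨Classical.arbitrary Y, trivial, fun _ _ => Subsingleton.elim _ _⟩
  cosurjective _ := ⟨default, trivial⟩

theorem eq_of_subsingleton [Subsingleton X] (v w : Val X A) : v = w := by
  ext x a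
  obtain ⟨x', hx'⟩ := v.cosurjective a
  obtain ⟨x'', hx''⟩ := w.cosurjective a
  rw [Subsingleton.elim x' x] at hx'
  rw [Subsingleton.elim x'' x] at hx''
  exact iff_of_true hx' hx''

end Val

/-- Contexts range over an infinite set. Merging variables with the same `F`-value moves them into a
fixed finite range, so that quantifiers over contexts can be replaced by finite conjunctions and
disjunctions. -/
theorem Context.exists_quotient (Y : Context) {α : Type*} [Finite α] (F : Y → α) :
    ∃ Z ⊆ Finset.range (Nat.card α), ∃ q : Y → Z, Function.Surjective q ∧
      ∀ y y', q y = q y' → F y = F y' := by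
  classical
  let e : α → ℕ := fun a => Finite.equivFin α a
  have he : Function.Injective e := Fin.val_injective.comp (Finite.equivFin α).injective
  refine ⟨Finset.univ.image (e ∘ F), ?_, fun y => ⟨e (F y), by simp⟩, ?_, ?_⟩
  · intro n hn
    obtain ⟨y, -, rfl⟩ := Finset.mem_image.1 hn
    simp [e]
  · rintro ⟨n, hn⟩
    obtain ⟨y, -, rfl⟩ := Finset.mem_image.1 hn
    exact ⟨y, rfl⟩
  · intro y y' h
    exact he (congrArg Subtype.val h)

/-! ### Definable properties of co-valuations -/

section Definable

variable {L : FirstOrder.Language.{u, v}} {X Y Z : Context}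

/-- A property of co-valuations in structures is definable if it is expressed by a formula. -/
def IsDefinable (P : ∀ M : ProtoStructure.{u, v, w} L, Val X M.carrier → Prop) : Prop :=
  ∃ φ : Formula L X, ∀ M : ProtoStructure.{u, v, w} L, M.IsStructure → ∀ v ∈ M.adm X,
    (M.Sat v φ ↔ P M v)

namespace IsDefinable

variable {P Q : ∀ M : ProtoStructure.{u, v, w} L, Val X M.carrier → Prop}

theorem congr (hP : IsDefinable P)
    (h : ∀ M : ProtoStructure.{u, v, w} L, M.IsStructure → ∀ v ∈ M.adm X, (P M v ↔ Q M v)) :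
    IsDefinable Q :=
  hP.imp fun _ hφ M hM v hv => (hφ M hM v hv).trans (h M hM v hv)

theorem sat (φ : Formula L X) :
    IsDefinable fun (M : ProtoStructure.{u, v, w} L) v => M.Sat v φ :=
  ⟨φ, fun _ _ _ _ => Iff.rfl⟩

theorem not (hP : IsDefinable P) : IsDefinable fun M v => ¬ P M v := by
  obtain ⟨φ, hφ⟩ := hP
  exact ⟨φ.neg, fun M hM v hv => by rw [ProtoStructure.Sat, hφ M hM v hv]⟩

theorem and (hP : IsDefinable P) (hQ : IsDefinable Q) :
    IsDefinable fun M v => P M v ∧ Q M v := by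
  obtain ⟨φ, hφ⟩ := hP
  obtain ⟨ψ, hψ⟩ := hQ
  exact ⟨φ.and ψ, fun M hM v hv => by rw [ProtoStructure.Sat, hφ M hM v hv, hψ M hM v hv]⟩

theorem or (hP : IsDefinable P) (hQ : IsDefinable Q) :
    IsDefinable fun M v => P M v ∨ Q M v :=
  (hP.not.and hQ.not).not.congr fun _ _ _ _ => by tauto

theorem const (p : Prop) :
    IsDefinable fun (M : ProtoStructure.{u, v, w} L) (_ : Val X M.carrier) => p := by
  have hf : IsDefinable fun (M : ProtoStructure.{u, v, w} L) (_ : Val X M.carrier) => False :=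
    ⟨.bot, fun M _ v _ => by rw [ProtoStructure.Sat]⟩
  by_cases hp : p
  · exact hf.not.congr fun _ _ _ _ => by tauto
  · exact hf.congr fun _ _ _ _ => by tauto

theorem exists_finite {ι : Type} [Finite ι]
    {P : ι → ∀ M : ProtoStructure.{u, v, w} L, Val X M.carrier → Prop}
    (hP : ∀ i, IsDefinable (P i)) : IsDefinable fun M v => ∃ i, P i M v := by
  induction ι using Finite.induction_empty_option with
  | of_equiv e ih =>
    exact (ih fun i => hP (e i)).congr fun M _ v _ =>
      (e.surjective.exists (p := fun i => P i M v)).symm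
  | h_empty => exact (const False).congr fun _ _ _ _ => by simp
  | h_option ih =>
    exact ((hP none).or (ih fun i => hP (some i))).congr fun M _ v _ =>
      (Option.exists (p := fun i => P i M v)).symm

theorem forall_finite {ι : Type} [Finite ι]
    {P : ι → ∀ M : ProtoStructure.{u, v, w} L, Val X M.carrier → Prop}
    (hP : ∀ i, IsDefinable (P i)) : IsDefinable fun M v => ∀ i, P i M v :=
  (exists_finite fun i => (hP i).not).not.congr fun _ _ _ _ => by simp

theorem exFr {P : ∀ M : ProtoStructure.{u, v, w} L, Val Y M.carrier → Prop} (hP : IsDefinable P)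
    (g : Val X Y) :
    IsDefinable fun M v => ∃ w ∈ M.adm Y, v = g.consolidation w ∧ P M w := by
  obtain ⟨φ, hφ⟩ := hP
  refine ⟨.exFr g φ, fun M hM v _ => ?_⟩
  rw [ProtoStructure.Sat]
  exact exists_congr fun w => and_congr_right fun hw => and_congr_right fun _ => hφ M hM w hw

end IsDefinable

namespace ProtoStructure

variable {M : ProtoStructure.{u, v, w} L}

theorem sat_rel {v : Val X M.carrier} {m : ℕ} {R : L.Relations m} {x : Fin m → X} :
    M.Sat v (.rel R x) ↔ ∃ a : Fin m → M.carrier, (∀ k, a k ∈ v.cell (x k)) ∧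
      FirstOrder.Language.Structure.RelMap R a := by
  rw [Sat]

theorem sat_exFr {v : Val X M.carrier} {g : Val X Y} {φ : Formula L Y} :
    M.Sat v (.exFr g φ) ↔ ∃ w ∈ M.adm Y, v = g.consolidation w ∧ M.Sat w φ := by
  rw [Sat]

theorem sat_neg {v : Val X M.carrier} {φ : Formula L X} : M.Sat v φ.neg ↔ ¬ M.Sat v φ := by
  rw [Sat]

theorem sat_and {v : Val X M.carrier} {φ ψ : Formula L X} :
    M.Sat v (φ.and ψ) ↔ M.Sat v φ ∧ M.Sat v ψ := by
  rw [Sat]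

/-- Common fragmentations can be found in contexts of bounded size. -/
theorem IsStructure.directed_bounded (hM : M.IsStructure) {u : Val X M.carrier}
    (hu : u ∈ M.adm X) {v : Val Y M.carrier} (hv : v ∈ M.adm Y) :
    ∃ Z ⊆ Finset.range (Nat.card (Set X × Set Y)), ∃ w ∈ M.adm Z,
      u.IsConsolidation w ∧ v.IsConsolidation w := by
  obtain ⟨Z, w, hw, ⟨g, rfl⟩, ⟨h, rfl⟩⟩ := hM.directed u hu v hv
  -- Cells of `w` lying in the same cells of `u` and of `v` are merged; the patterns descend to the
  -- quotient.
  obtain ⟨U, hU, q, hq, hqF⟩ := Context.exists_quotient Z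
    fun z => (({x | g.rel x z}, {y | h.rel y z}) : Set X × Set Y)
  refine ⟨U, hU, (Val.ofSurjective q hq).consolidation w, M.consolidation_mem _ w hw,
    ⟨g.descend q hq fun z z' hz x hx => ?_, (Val.descend_consolidation_assoc ..).symm⟩,
    ⟨h.descend q hq fun z z' hz y hy => ?_, (Val.descend_consolidation_assoc ..).symm⟩⟩
  · exact (Set.ext_iff.1 (Prod.ext_iff.1 (hqF z z' hz)).1 x).1 hx
  · exact (Set.ext_iff.1 (Prod.ext_iff.1 (hqF z z' hz)).2 y).1 hy

/-- There are uniquely covered cells of every fragmentation, below the given uniquely covered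
cells, that are related. -/
def PrivatelyRelated (M : ProtoStructure.{u, v, w} L) {m : ℕ} (R : L.Relations m) (y : Fin m → Y)
    (v : Val Y M.carrier) : Prop :=
  ∀ (Z : Context) (h : Val Y Z), ∀ w ∈ M.adm Z, v = h.consolidation w →
    ∃ z : Fin m → Z, (∀ k, uniquePart h.rel (y k) (z k)) ∧ M.Sat w (.rel R z)

/-- In any fragmentation, a cell `z k` containing `a k` can lie only in the cell of `y k`, because
every cell of `v` above it contains `a k`. -/
theorem privatelyRelated_of_uniquePart {m : ℕ} {R : L.Relations m} {y : Fin m → Y}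
    {v : Val Y M.carrier} {a : Fin m → M.carrier} (ha : ∀ k, uniquePart v.rel (y k) (a k))
    (hR : FirstOrder.Language.Structure.RelMap R a) : M.PrivatelyRelated R y v := by
  rintro Z h w - rfl
  choose z hz using fun k => w.cosurjective (a k)
  refine ⟨z, fun k => ?_, ?_⟩
  · obtain ⟨z', hyz', hz'⟩ := (ha k).1
    obtain ⟨y', hy'⟩ := h.cosurjective (z k)
    obtain rfl := (ha k).2 y' ⟨z k, hy', hz k⟩
    exact ⟨hy', fun y'' hy'' => (ha k).2 y'' ⟨z k, hy'', hz k⟩⟩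
  · rw [Sat]
    exact ⟨a, hz, hR⟩

end ProtoStructure

/-- In the `∃fr` case the witness need not be a fragmentation of `v`, but by directedness it has a
common fragmentation with `v`, and one of bounded size. The formula is then a finite disjunction
over pairs of patterns `h`, `l` that agree after composition with `k` and `g`. -/
theorem isDefinable_sat_consolidation (φ : Formula L Y) (k : Val Y X) :
    IsDefinable fun (M : ProtoStructure.{u, v, w} L) v => M.Sat (k.consolidation v) φ := by
  induction φ generalizing X with
  | bot => exact (IsDefinable.const False).congr fun M _ v _ => by rw [ProtoStructure.Sat]
  | @rel Y m R x =>
    have := IsDefinable.exists_finite fun y : Fin m → X =>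
      (IsDefinable.const.{u, v, w} (L := L) (X := X) (∀ i, k.rel (x i) (y i))).and
        (IsDefinable.sat (.rel R y))
    refine this.congr fun M _ v _ => ?_
    simp only [ProtoStructure.Sat]
    constructor
    · rintro ⟨y, hxy, a, ha, hR⟩
      exact ⟨a, fun i => ⟨y i, hxy i, ha i⟩, hR⟩
    · rintro ⟨a, ha, hR⟩
      choose y hxy hya using ha
      exact ⟨y, hxy, a, hya, hR⟩
  | neg φ ih => exact (ih k).not.congr fun M _ v _ => by rw [ProtoStructure.Sat]
  | and φ ψ ihφ ihψ =>
    exact ((ihφ k).and (ihψ k)).congr fun M _ v _ => by rw [ProtoStructure.Sat]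
  | @exFr Y Z g φ ih =>
    let F : Finset Context := (Finset.range (Nat.card (Set X × Set Z))).powerset
    have := IsDefinable.exists_finite fun U : F => IsDefinable.exists_finite fun h : Val X U.1 =>
      IsDefinable.exists_finite fun l : Val Z U.1 =>
        (IsDefinable.const.{u, v, w} (L := L) (X := X)
          (k.consolidation h = g.consolidation l)).and ((ih l).exFr h)
    refine this.congr fun M hM v hv => ?_
    simp only [ProtoStructure.Sat]
    constructor
    · rintro ⟨U, h, l, hkg, u, hu, rfl, hφ⟩
      refine ⟨l.consolidation u, M.consolidation_mem _ u hu, ?_, hφ⟩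
      rw [← Val.consolidation_assoc, ← Val.consolidation_assoc, hkg]
    · rintro ⟨w, hw, hkg, hφ⟩
      obtain ⟨U, hU, u, hu, ⟨h, rfl⟩, ⟨l, rfl⟩⟩ := hM.directed_bounded hv hw
      refine ⟨⟨U, Finset.mem_powerset.2 hU⟩, h, l, ?_, u, hu, rfl, hφ⟩
      rw [← Val.consolidation_assoc, ← Val.consolidation_assoc] at hkg
      exact Val.consolidation_left_injective u hkg

/-- A failure at some fragmentation persists when its cells with the same cells of `v` above them
are merged, because a related tuple of merged cells yields a related tuple of original ones. So
finitely many patterns need to be tested. -/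
theorem isDefinable_privatelyRelated {m : ℕ} (R : L.Relations m) (y : Fin m → Y) :
    IsDefinable fun (M : ProtoStructure.{u, v, w} L) v => M.PrivatelyRelated R y v := by
  let F : Finset Context := (Finset.range (Nat.card (Set Y))).powerset
  have := IsDefinable.forall_finite fun Z : F => IsDefinable.forall_finite fun h : Val Y Z.1 =>
    ((IsDefinable.forall_finite fun z : Fin m → Z.1 =>
      ((IsDefinable.const.{u, v, w} (L := L) (∀ k, uniquePart h.rel (y k) (z k))).and
        (IsDefinable.sat (.rel R z))).not).exFr h).not
  refine this.congr fun M _ v _ => ?_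
  constructor
  · rintro H Z' h' w hw rfl
    obtain ⟨Z, hZ, q, hq, hqF⟩ := Context.exists_quotient Z' fun z => ({y | h'.rel y z} : Set Y)
    have hh : ∀ z z', q z = q z' → ∀ y, h'.rel y z → h'.rel y z' :=
      fun z z' hz y hy => (Set.ext_iff.1 (hqF z z' hz) y).1 hy
    have H' := H ⟨Z, Finset.mem_powerset.2 hZ⟩ (h'.descend q hq hh)
    by_contra hcon
    refine H' ⟨(Val.ofSurjective q hq).consolidation w, M.consolidation_mem _ w hw,
      (Val.descend_consolidation_assoc ..).symm, ?_⟩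
    rintro z ⟨hz, hR⟩
    rw [ProtoStructure.Sat] at hR
    obtain ⟨a, ha, hR⟩ := hR
    choose z' hz' hza using ha
    refine hcon ⟨z', fun k => ⟨?_, fun y' hy' => (hz k).2 y' ⟨z' k, hz' k, hy'⟩⟩, ?_⟩
    · obtain ⟨z'', hz'', hy⟩ := (hz k).1
      exact hh _ _ (hz''.trans (hz' k).symm) _ hy
    · rw [ProtoStructure.Sat]
      exact ⟨a, hza, hR⟩
  · rintro H Z h ⟨w, hw, hv, hno⟩
    obtain ⟨z, hz, hR⟩ := H Z h w hw hv
    exact hno z ⟨hz, hR⟩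

end Definable


/-! ### The spectrum of a chain of co-valuations -/

section Spectrum

variable {A : Type w} {X : ℕ → Context} (c : (i : ℕ) → Val (X i) A)

/-- Upward closed families of sets that meet the family of cells of every co-valuation `c i`. -/
structure IsSelector (S : Set (Set A)) : Prop where
  mono : ∀ s ∈ S, ∀ t, s ⊆ t → t ∈ S
  meets : ∀ i, ∃ x, (c i).cell x ∈ S

/-- The spectrum of a sequence of co-valuations, the set of its minimal selectors. -/
def Spectrum : Type w := {S : Set (Set A) // Minimal (IsSelector c) S}

/-- The consolidations of the members of a sequence of co-valuations. -/
def InSpan {Y : Context} (u : Val Y A) : Prop := ∃ i, u.IsConsolidation (c i)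

variable {c}

theorem IsSelector.exists_spectrum_subset {S : Set (Set A)} (hS : IsSelector c S) :
    ∃ T : Spectrum c, T.1 ⊆ S := by
  obtain ⟨T, hTS, hT⟩ := zorn_superset_nonempty {S | IsSelector c S} (fun C hC hchain hne => by
    refine ⟨⋂₀ C, ⟨fun s hs t hst T hT => (hC hT).mono s (hs T hT) t hst, fun i => ?_⟩,
      fun T hT => Set.sInter_subset_of_mem hT⟩
    by_contra! hcon
    simp only [Set.mem_sInter, not_forall] at hcon
    choose T hT hxT using hcon
    have : Nonempty C := hne.to_subtype
    have : IsCodirectedOrder C := ⟨fun S T => (hchain.total S.2 T.2).elim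
      (fun h => ⟨S, le_rfl, h⟩) fun h => ⟨T, h, le_rfl⟩⟩
    -- Level `i` has finitely many cells. If each were missing from some selector of the chain, the
    -- smallest of these selectors would miss them all.
    obtain ⟨⟨T₀, hT₀⟩, hle⟩ := Finite.exists_ge fun x => (⟨T x, hT x⟩ : C)
    obtain ⟨x, hx⟩ := (hC hT₀).meets i
    exact hxT x (hle x hx)) S hS
  exact ⟨⟨T, hT⟩, hTS⟩

namespace Spectrum

variable (S : Spectrum c)

theorem mono {s t : Set A} (hs : s ∈ S.1) (hst : s ⊆ t) : t ∈ S.1 := S.2.1.mono s hs t hst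

theorem exists_cell_mem (i : ℕ) : ∃ x, (c i).cell x ∈ S.1 := S.2.1.meets i

/-- Otherwise the members of `S` not contained in `b` would form a smaller selector. This is the
main use of minimality. -/
theorem exists_level {b : Set A} (hb : b ∈ S.1) :
    ∃ j, ∀ y, (c j).cell y ∈ S.1 → (c j).cell y ⊆ b := by
  by_contra! h
  choose y hy hyb using h
  have hsel : IsSelector c {t ∈ S.1 | ¬ t ⊆ b} :=
    ⟨fun s hs t hst => ⟨S.mono hs.1 hst, fun h => hs.2 (hst.trans h)⟩,
      fun j => ⟨y j, hy j, hyb j⟩⟩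
  exact (S.2.2 hsel (fun t ht => ht.1) hb).2 subset_rfl

theorem eq_of_subset {S T : Spectrum c} (h : ∀ i x, (c i).cell x ∈ S.1 → (c i).cell x ∈ T.1) :
    S = T := by
  have hST : S.1 ⊆ T.1 := fun b hb => by
    obtain ⟨j, hj⟩ := S.exists_level hb
    obtain ⟨y, hy⟩ := S.exists_cell_mem j
    exact T.mono (h j y hy) (hj y hy)
  exact Subtype.ext (hST.antisymm (T.2.2 S.2.1 hST))

end Spectrum

variable (hc : ∀ i, (c i).IsConsolidation (c (i + 1)))

include hc

theorem isConsolidation_of_le {i j : ℕ} (hij : i ≤ j) : (c i).IsConsolidation (c j) := by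
  induction j, hij using Nat.le_induction with
  | base => exact Val.refl_isConsolidation _
  | succ j _ ih => exact ih.trans (hc j)

theorem InSpan.eventually {Y : Context} {u : Val Y A} (hu : InSpan c u) :
    ∃ i, ∀ j ≥ i, u.IsConsolidation (c j) := by
  obtain ⟨i, hi⟩ := hu
  exact ⟨i, fun j hij => hi.trans (isConsolidation_of_le hc hij)⟩

namespace Spectrum

variable (S : Spectrum c)

theorem exists_forall_level {b : Set A} (hb : b ∈ S.1) :
    ∃ j, ∀ l ≥ j, ∀ y, (c l).cell y ∈ S.1 → (c l).cell y ⊆ b := by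
  obtain ⟨j, hj⟩ := S.exists_level hb
  refine ⟨j, fun l hl y hy => ?_⟩
  obtain ⟨g, hg⟩ := isConsolidation_of_le hc hl
  obtain ⟨z, hz⟩ := g.cosurjective y
  have hsub : (c l).cell y ⊆ (c j).cell z := by
    rw [hg]
    exact Val.cell_subset_consolidation_cell.2 hz
  exact hsub.trans (hj z (S.mono hy hsub))

omit hc in
theorem exists_cell_mem_of_inSpan {Y : Context} {u : Val Y A} (hu : InSpan c u) :
    ∃ y, u.cell y ∈ S.1 := by
  obtain ⟨i, g, rfl⟩ := hu
  obtain ⟨x, hx⟩ := S.exists_cell_mem i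
  obtain ⟨y, hy⟩ := g.cosurjective x
  exact ⟨y, S.mono hx (Val.cell_subset_consolidation_cell.2 hy)⟩

/-- At a late level some cell in `S` lies in the consolidated cell of `y`. By
`cell_subset_consolidation_cell` this inclusion factors through a cell of `w`. This is what makes
lifting to the spectrum commute with consolidation. -/
theorem consolidation_cell_mem {Y Z : Context} {g : Val Y Z} {w : Val Z A} (hw : InSpan c w)
    {y : Y} : (g.consolidation w).cell y ∈ S.1 ↔ ∃ z, g.rel y z ∧ w.cell z ∈ S.1 := by
  constructor
  · intro hy
    obtain ⟨j, hj⟩ := S.exists_forall_level hc hy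
    obtain ⟨i, hi⟩ := hw.eventually hc
    obtain ⟨f, rfl⟩ := hi (max i j) (le_max_left _ _)
    obtain ⟨x, hx⟩ := S.exists_cell_mem (max i j)
    have hxy := hj _ (le_max_right i j) x hx
    rw [← Val.consolidation_assoc, Val.cell_subset_consolidation_cell] at hxy
    obtain ⟨z, hyz, hzx⟩ := hxy
    exact ⟨z, hyz, S.mono hx (Val.cell_subset_consolidation_cell.2 hzx)⟩
  · rintro ⟨z, hyz, hz⟩
    exact S.mono hz (Val.cell_subset_consolidation_cell.2 hyz)

end Spectrum

omit hc in
/-- A co-valuation in the span of `c`, as a co-valuation on the spectrum of `c`. -/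
def Val.lift {Y : Context} (u : Val Y A) (hu : InSpan c u) : Val Y (Spectrum c) where
  rel y S := u.cell y ∈ S.1
  coinjective y := by
    obtain ⟨a, hya, ha⟩ := u.coinjective y
    -- A minimal selector below the principal one at a private point `a` of `y` contains no cell of
    -- `u` other than that of `y`.
    have hsel : IsSelector c {t | a ∈ t} :=
      ⟨fun s hs t hst => hst hs, fun i => (c i).cosurjective a⟩
    obtain ⟨T, hT⟩ := hsel.exists_spectrum_subset
    obtain ⟨y', hy'⟩ := T.exists_cell_mem_of_inSpan hu
    obtain rfl := ha y' (hT hy')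
    exact ⟨T, hy', fun y'' hy'' => ha y'' (hT hy'')⟩
  cosurjective S := S.exists_cell_mem_of_inSpan hu

omit hc in
theorem InSpan.consolidation {Y Z : Context} (g : Val Y Z) {u : Val Z A} (hu : InSpan c u) :
    InSpan c (g.consolidation u) :=
  hu.imp fun _ h => Val.IsConsolidation.trans ⟨g, rfl⟩ h

omit hc in
theorem inSpan_self (i : ℕ) : InSpan c (c i) := ⟨i, Val.refl_isConsolidation _⟩

theorem Val.lift_consolidation {Y Z : Context} (g : Val Y Z) {u : Val Z A} (hu : InSpan c u) :
    (g.consolidation u).lift (hu.consolidation g) = g.consolidation (u.lift hu) := by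
  ext y S
  exact S.consolidation_cell_mem hc hu

theorem Val.lift_isConsolidation {Y Z : Context} {u : Val Y A} {w : Val Z A} (hu : InSpan c u)
    (hw : InSpan c w) (h : u.IsConsolidation w) :
    (u.lift hu).IsConsolidation (w.lift hw) := by
  obtain ⟨g, rfl⟩ := h
  exact ⟨g, Val.lift_consolidation hc g hw⟩

theorem InSpan.exists_common {Y Z : Context} {u : Val Y A} {w : Val Z A} (hu : InSpan c u)
    (hw : InSpan c w) : ∃ i, u.IsConsolidation (c i) ∧ w.IsConsolidation (c i) := by
  obtain ⟨i, hi⟩ := hu.eventually hc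
  obtain ⟨j, hj⟩ := hw.eventually hc
  exact ⟨max i j, hi _ (le_max_left _ _), hj _ (le_max_right _ _)⟩

theorem Val.lift_injective {Y : Context} {u w : Val Y A} (hu : InSpan c u) (hw : InSpan c w)
    (h : u.lift hu = w.lift hw) : u = w := by
  obtain ⟨i, ⟨f, rfl⟩, ⟨g, rfl⟩⟩ := hu.exists_common hc hw
  rw [Val.lift_consolidation hc f (inSpan_self i), Val.lift_consolidation hc g (inSpan_self i)] at h
  rw [Val.consolidation_left_injective _ h]

namespace Spectrum

omit hc in
/-- The topology generated by the sets of selectors that contain a given set. -/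
instance : TopologicalSpace (Spectrum c) :=
  TopologicalSpace.generateFrom (Set.range fun t : Set A => {S : Spectrum c | t ∈ S.1})

omit hc in
theorem isOpen_mem (t : Set A) : IsOpen {S : Spectrum c | t ∈ S.1} :=
  TopologicalSpace.isOpen_generateFrom_of_mem ⟨t, rfl⟩

/-- The cells of the `c i` form a base: by `exists_forall_level`, a cell of `S` at a late level lies
in any two given members of `S`. -/
theorem exists_cell_of_isOpen {O : Set (Spectrum c)} (hO : IsOpen O) {S : Spectrum c}
    (hS : S ∈ O) :
    ∃ i x, (c i).cell x ∈ S.1 ∧ ∀ T : Spectrum c, (c i).cell x ∈ T.1 → T ∈ O := by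
  induction hO generalizing S with
  | basic s hs =>
    obtain ⟨t, rfl⟩ := hs
    obtain ⟨i, hi⟩ := S.exists_level hS
    obtain ⟨x, hx⟩ := S.exists_cell_mem i
    exact ⟨i, x, hx, fun T hT => T.mono hT (hi x hx)⟩
  | univ =>
    obtain ⟨x, hx⟩ := S.exists_cell_mem 0
    exact ⟨0, x, hx, fun _ _ => trivial⟩
  | inter O O' _ _ ih ih' =>
    obtain ⟨i, x, hx, hO⟩ := ih hS.1
    obtain ⟨j, y, hy, hO'⟩ := ih' hS.2
    obtain ⟨k, hk⟩ := S.exists_forall_level hc hx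
    obtain ⟨l, hl⟩ := S.exists_forall_level hc hy
    obtain ⟨z, hz⟩ := S.exists_cell_mem (max k l)
    exact ⟨_, z, hz, fun T hT => ⟨hO T (T.mono hT (hk _ (le_max_left _ _) z hz)),
      hO' T (T.mono hT (hl _ (le_max_right _ _) z hz))⟩⟩
  | sUnion C _ ih =>
    obtain ⟨O, hO, hSO⟩ := hS
    obtain ⟨i, x, hx, h⟩ := ih O hO hSO
    exact ⟨i, x, hx, fun T hT => ⟨O, hO, h T hT⟩⟩

instance : T1Space (Spectrum c) := by
  refine t1Space_iff_exists_open.2 fun S T hST => ?_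
  by_contra! h
  exact hST (eq_of_subset fun i x hx => by simpa using h _ (isOpen_mem _) hx)

/-- Every open cover of the spectrum is refined by the cells of some `c i`. -/
theorem exists_refinement (U : Set (Set (Spectrum c))) (hU : ∀ s ∈ U, IsOpen s)
    (hcover : ⋃₀ U = Set.univ) :
    ∃ i, ∀ x, ∃ s ∈ U, {S : Spectrum c | (c i).cell x ∈ S.1} ⊆ s := by
  by_contra! h
  choose x hx using h
  -- If every level fails to refine `U`, the sets that are not small with respect to `U` form a
  -- selector. A minimal selector below it would be a point covered by no member of `U`.
  have hsel : IsSelector c {t | ∀ b, t ⊆ b → ∀ s ∈ U, ¬ {S : Spectrum c | b ∈ S.1} ⊆ s} :=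
    ⟨fun t ht t' htt' b hb => ht b (htt'.trans hb), fun i => ⟨x i, fun b hb s hs hbs =>
      hx i s hs (subset_trans (fun S hS => S.mono hS hb) hbs)⟩⟩
  obtain ⟨S, hS⟩ := hsel.exists_spectrum_subset
  obtain ⟨s, hs, hSs⟩ : S ∈ ⋃₀ U := hcover ▸ Set.mem_univ S
  obtain ⟨i, y, hy, hys⟩ := S.exists_cell_of_isOpen hc (hU s hs) hSs
  exact hS hy _ subset_rfl s hs fun T hT => hys T hT

theorem compactSpace : CompactSpace (Spectrum c) := by
  refine ⟨isCompact_of_finite_subcover fun {ι} U hU hcover => ?_⟩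
  obtain ⟨i, hi⟩ := exists_refinement hc (Set.range U) (by simpa using hU)
    (by rw [Set.sUnion_range]; exact Set.univ_subset_iff.1 hcover)
  simp only [Set.exists_range_iff] at hi
  choose k hk using hi
  classical
  refine ⟨Finset.univ.image k, fun S _ => ?_⟩
  obtain ⟨x, hx⟩ := S.exists_cell_mem i
  simp only [Finset.mem_image, Finset.mem_univ, true_and, Set.iUnion_exists,
    Set.iUnion_iUnion_eq', Set.mem_iUnion]
  exact ⟨x, hk x hx⟩

end Spectrum

omit hc

/-! ### The structure on the spectrum -/

variable {L : FirstOrder.Language.{u, v}} [L.IsRelational]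

/-- The proto-structure on the spectrum of a sequence of co-valuations on a structure `N`. -/
def spectrumStructure (N : ProtoStructure.{u, v, w} L) (c : (i : ℕ) → Val (X i) N.carrier)
    (hc : ∀ i, (c i).IsConsolidation (c (i + 1))) : ProtoStructure.{u, v, w} L where
  carrier := Spectrum c
  str :=
    { funMap := fun f _ => isEmptyElim f
      -- Selectors are related when no choice of their members witnesses the contrary; the
      -- complement is a union of open boxes, so the relation is closed.
      RelMap := fun R S => ∀ t : _ → Set N.carrier, (∀ k, t k ∈ (S k).1) →
        ∃ a, (∀ k, a k ∈ t k) ∧ FirstOrder.Language.Structure.RelMap R a }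
  adm Y := {v | ∃ (u : Val Y N.carrier) (hu : InSpan c u), v = u.lift hu}
  consolidation_mem := by
    rintro Y Z g _ ⟨u, hu, rfl⟩
    exact ⟨_, hu.consolidation g, (Val.lift_consolidation hc g hu).symm⟩

section

variable {N : ProtoStructure.{u, v, w} L} {c : (i : ℕ) → Val (X i) N.carrier}
  (hc : ∀ i, (c i).IsConsolidation (c (i + 1)))

theorem spectrumStructure_isCompact : (spectrumStructure N c hc).IsCompact := by
  refine ⟨inferInstanceAs (TopologicalSpace (Spectrum c)), Spectrum.compactSpace hc,
    inferInstanceAs (T1Space (Spectrum c)), ?_, ?_, ?_⟩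
  · rintro Y _ ⟨u, hu, rfl⟩ y
    exact Spectrum.isOpen_mem (u.cell y)
  · intro U hU hcover
    obtain ⟨i, hi⟩ := Spectrum.exists_refinement hc U hU hcover
    exact ⟨X i, _, ⟨c i, inSpan_self i, rfl⟩, hi⟩
  · intro m R
    change IsClosed {S : Fin m → Spectrum c | (spectrumStructure N c hc).str.RelMap R S}
    rw [← isOpen_compl_iff]
    have : {S : Fin m → Spectrum c | (spectrumStructure N c hc).str.RelMap R S}ᶜ =
        ⋃ t ∈ {t : Fin m → Set N.carrier | ¬ ∃ a, (∀ k, a k ∈ t k) ∧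
          FirstOrder.Language.Structure.RelMap R a},
          Set.pi Set.univ fun k => {S : Spectrum c | t k ∈ S.1} := by
      ext S
      change ¬ (∀ t : Fin m → Set N.carrier, (∀ k, t k ∈ (S k).1) →
        ∃ a, (∀ k, a k ∈ t k) ∧ FirstOrder.Language.Structure.RelMap R a) ↔ _
      simp only [not_forall, Set.mem_iUnion, Set.mem_pi, Set.mem_univ, true_implies, exists_prop]
      exact exists_congr fun _ => and_comm
    exact this ▸ isOpen_biUnion fun t _ =>
      isOpen_set_pi Set.finite_univ fun k _ => Spectrum.isOpen_mem (t k)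

theorem spectrumStructure_isOmega : (spectrumStructure N c hc).IsOmega := by
  refine ⟨X, fun i => (c i).lift (inSpan_self i), fun i => ⟨_, _, rfl⟩,
    fun i => Val.lift_isConsolidation hc _ _ (hc i), ?_⟩
  rintro Y _ ⟨u, hu, rfl⟩
  exact hu.imp fun i h => Val.lift_isConsolidation hc _ _ h

/-- If a consolidation of some `c i` satisfies that cells are privately related, then so do
selectors in their privately covered parts. -/
theorem exists_relMap_of_privatelyRelated (hcN : ∀ i, c i ∈ N.adm (X i)) {Y : Context}
    {u : Val Y N.carrier} (hu : InSpan c u) {m : ℕ} {R : L.Relations m} {y : Fin m → Y}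
    (hR : N.PrivatelyRelated R y u) :
    ∃ S : Fin m → Spectrum c, (∀ k, uniquePart (u.lift hu).rel (y k) (S k)) ∧
      (spectrumStructure N c hc).str.RelMap R S := by
  obtain ⟨i, hi⟩ := hu.eventually hc
  have hz : ∀ j, i ≤ j → ∃ z : Fin m → X j,
      (∀ k y', (c j).cell (z k) ⊆ u.cell y' → y k = y') ∧ N.Sat (c j) (.rel R z) := by
    intro j hj
    obtain ⟨h, hh⟩ := hi j hj
    obtain ⟨z, hz, hRz⟩ := hR _ h (c j) (hcN j) hh
    refine ⟨z, fun k y' hy' => (hz k).2 y' ?_, hRz⟩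
    rw [hh] at hy'
    exact Val.cell_subset_consolidation_cell.1 hy'
  -- Levels below `i` only need some tuple, to make `z` total; it is obtained by moving the tuple at
  -- level `i` to coarser cells.
  have hz' : ∀ j, ∃ z : Fin m → X j, i ≤ j →
      (∀ k y', (c j).cell (z k) ⊆ u.cell y' → y k = y') ∧ N.Sat (c j) (.rel R z) := by
    intro j
    by_cases hj : i ≤ j
    · exact (hz j hj).imp fun z h _ => h
    · obtain ⟨z, hz⟩ := hz i le_rfl
      obtain ⟨g, hg⟩ := isConsolidation_of_le hc (le_of_not_ge hj)
      choose f hf using g.cosurjective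
      exact ⟨fun k => f (z k), fun h => absurd h hj⟩
  choose z hz using hz'
  -- The tuples `z j` need not cohere between levels. As each level is finite, the ultrafilter picks
  -- at level `l` a cell containing almost all the chosen ones, so the limit is a selector. Every
  -- member of a minimal selector below it still contains almost all chosen cells.
  let F : Ultrafilter ℕ := Filter.hyperfilter ℕ
  have hF : ∀ᶠ j in (F : Filter ℕ), i ≤ j :=
    Nat.hyperfilter_le_atTop (Filter.eventually_ge_atTop i)
  have hsel : ∀ k, IsSelector c {t | ∀ᶠ j in (F : Filter ℕ), (c j).cell (z j k) ⊆ t} := by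
    refine fun k => ⟨fun s hs t hst => hs.mono fun j hj => hj.trans hst, fun l => ?_⟩
    have : ∀ᶠ j in (F : Filter ℕ), ∃ x : X l, (c j).cell (z j k) ⊆ (c l).cell x := by
      filter_upwards [Nat.hyperfilter_le_atTop (Filter.eventually_ge_atTop l)] with j hj
      obtain ⟨g, hg⟩ := isConsolidation_of_le hc hj
      obtain ⟨x, hx⟩ := g.cosurjective (z j k)
      exact ⟨x, hg ▸ Val.cell_subset_consolidation_cell.2 hx⟩
    exact Ultrafilter.eventually_exists_iff.1 this
  choose S hS using fun k => (hsel k).exists_spectrum_subset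
  refine ⟨S, fun k => ?_, fun t ht => ?_⟩
  · have hyS : ∀ y', u.cell y' ∈ (S k).1 → y k = y' := fun y' hy' => by
      obtain ⟨j, hj, hij⟩ := ((hS k hy').and hF).exists
      exact (hz j hij).1 k y' hj
    obtain ⟨y', hy'⟩ := (S k).exists_cell_mem_of_inSpan hu
    obtain rfl := hyS y' hy'
    exact ⟨hy', hyS⟩
  · obtain ⟨j, hj, hij⟩ := ((Filter.eventually_all.2 fun k => hS k (ht k)).and hF).exists
    have hRz := (hz j hij).2
    rw [ProtoStructure.Sat] at hRz
    exact hRz.imp fun a ha => ⟨fun k => hj k (ha.1 k), ha.2⟩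

/-! ### Truth in the spectrum under the Tarski–Vaught condition `hgen` -/

variable (hN : N.IsStructure) (hcN : ∀ i, c i ∈ N.adm (X i))
  (hgen : ∀ {Y Z : Context} (u : Val Y N.carrier), InSpan c u → ∀ (h : Val Y Z) (φ : Formula L Z),
    N.Sat u (.exFr h φ) → ∃ w, InSpan c w ∧ u = h.consolidation w ∧ N.Sat w φ)

omit [L.IsRelational] in
theorem InSpan.mem_adm {c : (i : ℕ) → Val (X i) N.carrier} (hcN : ∀ i, c i ∈ N.adm (X i))
    {Y : Context} {u : Val Y N.carrier} (hu : InSpan c u) : u ∈ N.adm Y := by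
  obtain ⟨i, g, rfl⟩ := hu
  exact N.consolidation_mem g _ (hcN i)

include hN hcN hgen

omit [L.IsRelational] in
-- Axiom (II) in `N` gives a private witness in a co-valuation that may lie outside the span of `c`.
-- What it witnesses is definable over a fragmentation of `u`, so `hgen` moves it into the span.
theorem exists_privatelyRelated {Y : Context} {u : Val Y N.carrier} (hu : InSpan c u)
    {m : ℕ} {R : L.Relations m} {x : Fin m → Y} (hR : N.Sat u (.rel R x)) :
    ∃ (Z : Context) (w : Val Z N.carrier) (_ : InSpan c w) (y : Fin m → Z),
      (∀ k, w.cell (y k) ⊆ u.cell (x k)) ∧ N.PrivatelyRelated R y w := by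
  obtain ⟨Z, w, hw, y, a, ha, hyx, hRa⟩ := hN.rel_witness R u (hu.mem_adm hcN) x hR
  obtain ⟨W, t, ht, ⟨h, rfl⟩, ⟨k, rfl⟩⟩ := hN.directed u (hu.mem_adm hcN) w hw
  obtain ⟨θ, hθ⟩ := isDefinable_privatelyRelated.{u, v, w} R y
  obtain ⟨θ', hθ'⟩ := isDefinable_sat_consolidation.{u, v, w} θ k
  have hsat : N.Sat (h.consolidation t) (.exFr h θ') := by
    rw [ProtoStructure.Sat]
    exact ⟨t, ht, rfl, (hθ' N hN t ht).2 ((hθ N hN _ hw).2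
      (ProtoStructure.privatelyRelated_of_uniquePart ha hRa))⟩
  obtain ⟨t', ht', htt', hsat'⟩ := hgen _ hu h θ' hsat
  -- The inclusions between cells depend only on the patterns `h` and `k`, so they survive replacing
  -- `t` by `t'`.
  refine ⟨Z, k.consolidation t', ht'.consolidation k, y, fun i => ?_, ?_⟩
  · rw [htt', Val.consolidation_cell_subset_iff]
    exact Val.consolidation_cell_subset_iff.1 (hyx i)
  · exact (hθ N hN _ ((ht'.consolidation k).mem_adm hcN)).1
      ((hθ' N hN t' (ht'.mem_adm hcN)).1 hsat')

theorem exists_lift_relMap {Y : Context} {u : Val Y N.carrier} (hu : InSpan c u)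
    {m : ℕ} {R : L.Relations m} {x : Fin m → Y} (hR : N.Sat u (.rel R x)) :
    ∃ (Z : Context) (w : Val Z N.carrier) (hw : InSpan c w) (y : Fin m → Z)
      (S : Fin m → Spectrum c), (∀ k, uniquePart (w.lift hw).rel (y k) (S k)) ∧
      (∀ k, (w.lift hw).cell (y k) ⊆ (u.lift hu).cell (x k)) ∧
      (spectrumStructure N c hc).str.RelMap R S := by
  obtain ⟨Z, w, hw, y, hyx, hRy⟩ := exists_privatelyRelated hN hcN hgen hu hR
  obtain ⟨S, hS, hRS⟩ := exists_relMap_of_privatelyRelated hc hcN hw hRy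
  exact ⟨Z, w, hw, y, S, hS, fun k T hT => T.mono hT (hyx k), hRS⟩

/-- For relations, the definition of `RelMap` on selectors gives one direction and
`exists_lift_relMap` the other. For `∃fr`, injectivity of the lift returns witnesses to `N`, and
`hgen` supplies them in the span. -/
theorem spectrumStructure_sat_lift {Y : Context} (φ : Formula L Y) (u : Val Y N.carrier)
    (hu : InSpan c u) : (spectrumStructure N c hc).Sat (u.lift hu) φ ↔ N.Sat u φ := by
  induction φ with
  | bot => simp only [ProtoStructure.Sat]
  | rel R x =>
    constructor
    · intro h
      obtain ⟨S, hS, hR⟩ := ProtoStructure.sat_rel.1 h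
      exact ProtoStructure.sat_rel.2 (hR _ hS)
    · intro h
      obtain ⟨Z, w, hw, y, S, hS, hyx, hR⟩ := exists_lift_relMap hc hN hcN hgen hu h
      exact ProtoStructure.sat_rel.2 ⟨S, fun k => hyx k (hS k).1, hR⟩
  | neg φ ih => simp only [ProtoStructure.Sat, ih u hu]
  | and φ ψ ihφ ihψ => simp only [ProtoStructure.Sat, ihφ u hu, ihψ u hu]
  | exFr g φ ih =>
    constructor
    · intro h
      obtain ⟨_, ⟨w, hw, rfl⟩, huw, hφ⟩ := ProtoStructure.sat_exFr.1 h
      exact ProtoStructure.sat_exFr.2 ⟨w, hw.mem_adm hcN, Val.lift_injective hc _ _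
        (huw.trans (Val.lift_consolidation hc g hw).symm), (ih w hw).1 hφ⟩
    · intro h
      obtain ⟨w, hw, rfl, hφ⟩ := hgen u hu g φ h
      exact ProtoStructure.sat_exFr.2 ⟨_, ⟨w, hw, rfl⟩, Val.lift_consolidation hc g hw, (ih w hw).2 hφ⟩

theorem spectrumStructure_isStructure : (spectrumStructure N c hc).IsStructure where
  directed := by
    rintro Y Z _ ⟨u, hu, rfl⟩ _ ⟨w, hw, rfl⟩
    obtain ⟨i, hi, hi'⟩ := hu.exists_common hc hw
    exact ⟨X i, _, ⟨c i, inSpan_self i, rfl⟩, Val.lift_isConsolidation hc _ _ hi,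
      Val.lift_isConsolidation hc _ _ hi'⟩
  rel_witness := by
    rintro m R Y _ ⟨u, hu, rfl⟩ x hR
    obtain ⟨Z, w, hw, y, S, hS, hyx, hRS⟩ := exists_lift_relMap hc hN hcN hgen hu
      ((spectrumStructure_sat_lift hc hN hcN hgen _ u hu).1 hR)
    exact ⟨Z, _, ⟨w, hw, rfl⟩, y, S, hS, hyx, hRS⟩

end
end Spectrum

/-! ### Countability of the set of formulas -/

section Countable

variable {L : FirstOrder.Language.{u, v}}

/-- The nesting depth of connectives and quantifiers. -/
def Formula.depth : {X : Context} → Formula L X → ℕ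
  | _, .bot => 0
  | _, .rel _ _ => 0
  | _, .neg φ => φ.depth + 1
  | _, .and φ ψ => max φ.depth ψ.depth + 1
  | _, .exFr _ φ => φ.depth + 1

theorem Formula.countable_depth_lt [Countable (Σ m, L.Relations m)] (n : ℕ) (X : Context) :
    {φ : Formula L X | φ.depth < n}.Countable := by
  induction n generalizing X with
  | zero => simp
  | succ n ih =>
    have hsub : {φ : Formula L X | φ.depth < n + 1} ⊆
        {.bot} ∪ (Set.range fun p : Σ r : (Σ m, L.Relations m), Fin r.1 → X => .rel p.1.2 p.2) ∪
        (neg '' {φ | φ.depth < n}) ∪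
        (Set.image2 and {φ | φ.depth < n} {φ | φ.depth < n}) ∪
        ⋃ p : Σ Y : Context, Val X Y, exFr p.2 '' {φ | φ.depth < n} := by
      intro φ hφ
      cases φ with
      | bot => simp
      | rel R x => exact .inl (.inl (.inl (.inr ⟨⟨⟨_, R⟩, x⟩, rfl⟩)))
      | neg φ => exact .inl (.inl (.inr ⟨φ, Nat.lt_of_succ_lt_succ hφ, rfl⟩))
      | and φ ψ =>
        have h := max_lt_iff.1 (Nat.lt_of_succ_lt_succ hφ)
        exact .inl (.inr ⟨φ, h.1, ψ, h.2, rfl⟩)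
      | exFr g φ => exact .inr (Set.mem_iUnion.2 ⟨⟨_, g⟩, φ, Nat.lt_of_succ_lt_succ hφ, rfl⟩)
    refine Set.Countable.mono hsub ?_
    exact ((((Set.countable_singleton _).union (Set.countable_range _)).union
      ((ih X).image _)).union ((ih X).image2 (ih X) _)).union
      (Set.countable_iUnion fun p => (ih p.1).image _)

instance [Countable (Σ m, L.Relations m)] (X : Context) : Countable (Formula L X) := by
  rw [← Set.countable_univ_iff]
  exact (Set.countable_iUnion fun n => Formula.countable_depth_lt n X).mono
    fun φ _ => Set.mem_iUnion.2 ⟨φ.depth + 1, Nat.lt_succ_self _⟩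

end Countable

/-! ### Complete types and isolation -/

section Types

variable {L : FirstOrder.Language.{u, v}} {T : Theory L} {X Y : Context}

/-- The complete type of a co-valuation. -/
def ProtoStructure.typeOf (M : ProtoStructure.{u, v, w} L) (v : Val X M.carrier) : PType L X :=
  {φ | M.Sat v φ}

theorem ProtoStructure.typeOf_isComplete (M : ProtoStructure.{u, v, w} L) (v : Val X M.carrier) :
    (M.typeOf v).IsComplete := fun φ => by
  by_cases h : M.Sat v φ
  · exact .inl h
  · exact .inr (sat_neg.2 h)

theorem ProtoStructure.typeOf_eq_of_subset {M N : ProtoStructure.{u, v, w} L}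
    {v : Val X M.carrier} {v' : Val X N.carrier} (h : M.typeOf v ⊆ N.typeOf v') :
    M.typeOf v = N.typeOf v' :=
  h.antisymm fun φ hφ => (M.typeOf_isComplete v φ).resolve_right fun hn => sat_neg.1 (h hn) hφ

theorem ProtoStructure.eq_typeOf {M : ProtoStructure.{u, v, w} L} {v : Val X M.carrier}
    {p : PType L X} (hp : p.IsComplete) (h : ∀ φ ∈ p, M.Sat v φ) : p = M.typeOf v :=
  Set.Subset.antisymm h fun φ hφ => (hp φ).resolve_right fun hn => sat_neg.1 (h _ hn) hφ

namespace Theory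

/-- The point of the type space given by a co-valuation in a model. -/
def TypeSpace.ofVal {M : ProtoStructure.{u, v, w} L} (hM : M.IsModel T) {v : Val X M.carrier}
    (hv : v ∈ M.adm X) : TypeSpace.{u, v, w} T X :=
  ⟨M.typeOf v, M.typeOf_isComplete v, M, hM, v, hv, fun _ h => h⟩

/-- A realization of the isolating formula has a type containing `N.typeOf v`. Complete types are
not properly contained in one another, so the two agree and the isolating formula holds at `v`
itself. -/
theorem isIsolated_typeOf_iff {N : ProtoStructure.{u, v, w} L} {v : Val X N.carrier} :
    IsIsolated.{u, v, w} T (N.typeOf v) ↔ ∃ φ : Formula L X, N.Sat v φ ∧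
      (∃ M : ProtoStructure.{u, v, w} L, M.IsModel T ∧ M.Realizes {φ}) ∧
      ∀ M : ProtoStructure.{u, v, w} L, M.IsModel T → ∀ v' ∈ M.adm X, M.Sat v' φ →
        M.typeOf v' = N.typeOf v := by
  constructor
  · rintro ⟨φ, ⟨M, hM, v', hv', h⟩, hφ⟩
    have H : ∀ M : ProtoStructure.{u, v, w} L, M.IsModel T → ∀ v' ∈ M.adm X, M.Sat v' φ →
        M.typeOf v' = N.typeOf v := fun M hM v' hv' h =>
      (ProtoStructure.typeOf_eq_of_subset (hφ M hM v' hv' h)).symm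
    refine ⟨φ, ?_, ⟨M, hM, v', hv', h⟩, H⟩
    have := H M hM v' hv' (h φ rfl)
    exact (Set.ext_iff.1 this φ).1 (h φ rfl)
  · rintro ⟨φ, -, hcons, hφ⟩
    exact ⟨φ, hcons, fun M hM v' hv' h ψ hψ => (Set.ext_iff.1 (hφ M hM v' hv' h) ψ).2 hψ⟩

/-- If `χ` isolates the type of `u`, then `∃fr_g χ` isolates that of the consolidation, because the
truth of `ψ` there is expressed by a formula at `u`. -/
theorem IsIsolated.consolidation {N : ProtoStructure.{u, v, w} L} (hN : N.IsStructure)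
    {u : Val Y N.carrier} (hu : u ∈ N.adm Y) (h : IsIsolated.{u, v, w} T (N.typeOf u))
    (g : Val X Y) : IsIsolated.{u, v, w} T (N.typeOf (g.consolidation u)) := by
  obtain ⟨χ, ⟨M, hM, v, hv, hχ⟩, hiso⟩ := h
  refine ⟨.exFr g χ, ⟨M, hM, _, M.consolidation_mem g v hv, ?_⟩, ?_⟩
  · rintro _ rfl
    exact ProtoStructure.sat_exFr.2 ⟨v, hv, rfl, hχ χ rfl⟩
  · intro M' hM' v' _ hsat ψ hψ
    obtain ⟨w, hw, rfl, hwχ⟩ := ProtoStructure.sat_exFr.1 hsat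
    obtain ⟨ψ', hψ'⟩ := isDefinable_sat_consolidation.{u, v, w} ψ g
    exact (hψ' M' hM'.1 w hw).1 (hiso M' hM' w hw hwχ ψ' ((hψ' N hN u hu).2 hψ))

/-- If isolated types are dense, then every consistent formula belongs to an isolated type. -/
theorem exists_isIsolated {X : ℕ → Context} (hX : ∀ n, (X n).card = n)
    (hd : ∀ n, IsolatedDense.{u, v, w} T (X n)) {Y : Context} {φ : Formula L Y}
    {N : ProtoStructure.{u, v, w} L} (hN : N.IsModel T) {v : Val Y N.carrier} (hv : v ∈ N.adm Y)
    (hφ : N.Sat v φ) :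
    ∃ M : ProtoStructure.{u, v, w} L, M.IsModel T ∧ ∃ w ∈ M.adm Y, M.Sat w φ ∧
      IsIsolated.{u, v, w} T (M.typeOf w) := by
  -- Density is given only for the contexts `X n`; the formula is renamed along a bijection, and the
  -- isolated type found is renamed back.
  obtain ⟨e⟩ : Nonempty (Y ≃ X Y.card) := ⟨Finset.equivOfCardEq (hX _).symm⟩
  let f := Val.ofSurjective e e.surjective
  have hopen : IsOpen (basicOpen.{u, v, w} T (.exFr f φ)) :=
    TopologicalSpace.isOpen_generateFrom_of_mem ⟨_, rfl⟩
  obtain ⟨p, hp, hpiso⟩ := (hd Y.card).inter_open_nonempty _ hopen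
    ⟨TypeSpace.ofVal hN (N.consolidation_mem f v hv), ProtoStructure.sat_exFr.2 ⟨v, hv, rfl, hφ⟩⟩
  obtain ⟨p, hpc, M, hM, u, hu, hpu⟩ := p
  obtain ⟨w, hw, rfl, hwφ⟩ := ProtoStructure.sat_exFr.1 (hpu _ hp)
  obtain rfl := ProtoStructure.eq_typeOf hpc hpu
  have := IsIsolated.consolidation hM.1 hu hpiso (Val.ofSurjective e.symm e.symm.surjective)
  rw [Val.ofSurjective_consolidation_ofSurjective] at this
  exact ⟨M, hM, w, hw, hwφ, this⟩

/-- Conjunction makes the sets `[φ]` a base and not merely a subbase, so density can be tested on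
single formulas. -/
theorem isolatedDense_of_forall
    (h : ∀ (φ : Formula L X) (N : ProtoStructure.{u, v, w} L), N.IsModel T → ∀ v ∈ N.adm X,
      N.Sat v φ → ∃ M : ProtoStructure.{u, v, w} L, M.IsModel T ∧ ∃ w ∈ M.adm X, M.Sat w φ ∧
        IsIsolated.{u, v, w} T (M.typeOf w)) : IsolatedDense.{u, v, w} T X := by
  have hbasis : ∀ U : Set (TypeSpace.{u, v, w} T X), IsOpen U → ∀ p ∈ U,
      ∃ φ, p ∈ basicOpen.{u, v, w} T φ ∧ basicOpen.{u, v, w} T φ ⊆ U := by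
    intro U hU
    induction hU with
    | basic U hU =>
      obtain ⟨φ, rfl⟩ := hU
      exact fun p hp => ⟨φ, hp, subset_rfl⟩
    | univ =>
      rintro ⟨p, hp, N, hN, v, hv, hpv⟩ -
      exact ⟨Formula.bot.neg, (hp .bot).resolve_left fun h => by
        simpa only [ProtoStructure.Sat] using hpv _ h, Set.subset_univ _⟩
    | inter U V _ _ ihU ihV =>
      rintro p ⟨hpU, hpV⟩
      obtain ⟨φ, hpφ, hφ⟩ := ihU p hpU
      obtain ⟨ψ, hpψ, hψ⟩ := ihV p hpV
      refine ⟨φ.and ψ, ?_, fun q hq => ⟨hφ ?_, hψ ?_⟩⟩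
      · obtain ⟨p, hp, N, hN, v, hv, hpv⟩ := p
        obtain rfl := ProtoStructure.eq_typeOf hp hpv
        exact ProtoStructure.sat_and.2 ⟨hpφ, hpψ⟩
      all_goals
        obtain ⟨p, hp, N, hN, v, hv, hpv⟩ := q
        obtain rfl := ProtoStructure.eq_typeOf hp hpv
      · exact (ProtoStructure.sat_and.1 hq).1
      · exact (ProtoStructure.sat_and.1 hq).2
    | sUnion C _ ih =>
      rintro p ⟨U, hU, hpU⟩
      obtain ⟨φ, hp, hφ⟩ := ih U hU p hpU
      exact ⟨φ, hp, hφ.trans (Set.subset_sUnion_of_mem hU)⟩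
  refine dense_iff_inter_open.2 fun U hU ⟨p, hp⟩ => ?_
  obtain ⟨φ, hpφ, hφU⟩ := hbasis U hU p hp
  obtain ⟨p, hpc, N, hN, v, hv, hpv⟩ := p
  obtain ⟨M, hM, w, hw, hwφ, hiso⟩ := h φ N hN v hv (hpv φ hpφ)
  exact ⟨TypeSpace.ofVal hM hw, hφU hwφ, hiso⟩

/-- Atomic models of complete theories realize all consistent formulas. -/
theorem IsAtomicModel.isolatedDense {M : ProtoStructure.{u, v, w} L} (hM : IsAtomicModel T M)
    (hT : Decides.{u, v, w} T) (X : Context) : IsolatedDense.{u, v, w} T X := by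
  refine isolatedDense_of_forall fun φ N hN v hv hφ => ?_
  -- The universe of a model is nonempty, hence so is `X`. The total relation is then a pattern `g`,
  -- and `∃fr_g φ` is the sentence saying that `φ` is realized.
  obtain ⟨v₀, hv₀, -⟩ := hN.2
  obtain ⟨a, -⟩ := v₀.coinjective ⟨0, by simp [starContext]⟩
  obtain ⟨x, -⟩ := v.cosurjective a
  have : Nonempty X := ⟨x⟩
  let _ : Unique starContext := ⟨⟨⟨0, by simp [starContext]⟩⟩, fun x => Subtype.ext (by
    simpa [starContext] using x.2)⟩
  let g := Val.total starContext X
  rcases hT (.exFr g φ) with h | h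
  · obtain ⟨u, hu, hsat⟩ := h M hM.2.1
    obtain ⟨w, hw, -, hwφ⟩ := ProtoStructure.sat_exFr.1 (hsat _ rfl)
    exact ⟨M, hM.2.1, w, hw, hwφ, hM.2.2 X (TypeSpace.ofVal hM.2.1 hw) ⟨w, hw, fun _ h => h⟩⟩
  · obtain ⟨u, hu, hsat⟩ := h N hN
    exact absurd (ProtoStructure.sat_exFr.2 ⟨v, hv, Val.eq_of_subsingleton _ _, hφ⟩)
      (ProtoStructure.sat_neg.1 (hsat _ rfl))

/-! ### Generic chains of isolated types -/

section Chain

variable {X : ℕ → Context} (hX : ∀ n, (X n).card = n)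
  (hd : ∀ n, IsolatedDense.{u, v, w} T (X n)) {N : ProtoStructure.{u, v, w} L} (hN : N.IsModel T)

include hX hd hN

/-- The isolated type is found in another model `M`, under `φ` and `χ'`. Since `χ'` forces the
consolidation by `h` to have the type of `v`, the formula `∃fr_h ξ` with `ξ` isolating is true at
`v`, which brings the type back to `N`. -/
theorem exists_isIsolated_fragmentation {Y Z : Context} {v : Val Y N.carrier} (hv : v ∈ N.adm Y)
    (hiso : IsIsolated.{u, v, w} T (N.typeOf v)) {h : Val Y Z} {φ : Formula L Z}
    (hφ : N.Sat v (.exFr h φ)) :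
    ∃ w ∈ N.adm Z, v = h.consolidation w ∧ N.Sat w φ ∧ IsIsolated.{u, v, w} T (N.typeOf w) := by
  obtain ⟨χ, hvχ, -, hχ⟩ := isIsolated_typeOf_iff.1 hiso
  obtain ⟨χ', hχ'⟩ := isDefinable_sat_consolidation.{u, v, w} χ h
  obtain ⟨w, hw, rfl, hwφ⟩ := ProtoStructure.sat_exFr.1 hφ
  obtain ⟨M, hM, u, hu, huφ, huiso⟩ := exists_isIsolated (φ := φ.and χ') hX hd hN hw
    (ProtoStructure.sat_and.2 ⟨hwφ, (hχ' N hN.1 w hw).2 hvχ⟩)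
  obtain ⟨huφ, huχ⟩ := ProtoStructure.sat_and.1 huφ
  have heq := hχ M hM _ (M.consolidation_mem h u hu) ((hχ' M hM.1 u hu).1 huχ)
  obtain ⟨ξ, huξ, -, hξ⟩ := isIsolated_typeOf_iff.1 huiso
  have hmem : Formula.exFr h ξ ∈ M.typeOf (h.consolidation u) :=
    ProtoStructure.sat_exFr.2 ⟨u, hu, rfl, huξ⟩
  rw [heq] at hmem
  obtain ⟨w', hw', hww', hwξ⟩ := ProtoStructure.sat_exFr.1 hmem
  have heq' := hξ N hN w' hw' hwξ
  refine ⟨w', hw', hww', ?_, heq' ▸ huiso⟩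
  change φ ∈ N.typeOf w'
  exact heq' ▸ huφ

theorem exists_witness_fragmentation {W Y Z : Context} {v : Val W N.carrier} (hv : v ∈ N.adm W)
    (hiso : IsIsolated.{u, v, w} T (N.typeOf v)) {u : Val Y N.carrier} (huv : u.IsConsolidation v)
    {h : Val Y Z} {φ : Formula L Z} (hφ : N.Sat u (.exFr h φ)) :
    ∃ (W' : Context), ∃ v' ∈ N.adm W', IsIsolated.{u, v, w} T (N.typeOf v') ∧
      v.IsConsolidation v' ∧ ∃ w : Val Z N.carrier, w.IsConsolidation v' ∧
        u = h.consolidation w ∧ N.Sat w φ := by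
  obtain ⟨w, hw, rfl, hwφ⟩ := ProtoStructure.sat_exFr.1 hφ
  obtain ⟨g, hg⟩ := huv
  obtain ⟨W', t, ht, ⟨k, rfl⟩, ⟨f, rfl⟩⟩ := hN.1.directed v hv w hw
  obtain ⟨φ', hφ'⟩ := isDefinable_sat_consolidation.{u, v, w} φ f
  obtain ⟨t', ht', hkt, ht'φ, ht'iso⟩ := exists_isIsolated_fragmentation hX hd hN hv hiso
    (ProtoStructure.sat_exFr.2 ⟨t, ht, rfl, (hφ' N hN.1 t ht).2 hwφ⟩)
  refine ⟨W', t', ht', ht'iso, ⟨k, hkt⟩, f.consolidation t', ⟨f, rfl⟩, ?_,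
    (hφ' N hN.1 t' ht').1 ht'φ⟩
  -- The two descriptions of `u` over `t` agree as patterns, so the identity transfers to `t'`.
  rw [← Val.consolidation_assoc, ← Val.consolidation_assoc] at hg
  rw [← Val.consolidation_assoc, ← Val.consolidation_assoc,
    Val.consolidation_left_injective t hg, Val.consolidation_assoc, Val.consolidation_assoc, hkt]

/-- As contexts are finite, `v` has finitely many consolidations in `Y`. They are treated one after
another, and earlier witnesses remain consolidations of later fragmentations. -/
theorem exists_fragmentation_witnessing {W : Context} {v : Val W N.carrier} (hv : v ∈ N.adm W)
    (hiso : IsIsolated.{u, v, w} T (N.typeOf v)) {Y Z : Context} (h : Val Y Z) (φ : Formula L Z) :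
    ∃ (W' : Context), ∃ v' ∈ N.adm W', IsIsolated.{u, v, w} T (N.typeOf v') ∧
      v.IsConsolidation v' ∧ ∀ u : Val Y N.carrier, u.IsConsolidation v →
        N.Sat u (.exFr h φ) → ∃ w : Val Z N.carrier, w.IsConsolidation v' ∧
          u = h.consolidation w ∧ N.Sat w φ := by
  have hfin : {u : Val Y N.carrier | u.IsConsolidation v}.Finite :=
    (Set.finite_range fun g : Val Y W => g.consolidation v).subset
      fun u ⟨g, hg⟩ => ⟨g, hg.symm⟩
  suffices ∀ s : Set (Val Y N.carrier), s.Finite → (∀ u ∈ s, u.IsConsolidation v) →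
      ∃ (W' : Context), ∃ v' ∈ N.adm W', IsIsolated.{u, v, w} T (N.typeOf v') ∧
        v.IsConsolidation v' ∧ ∀ u ∈ s,
          N.Sat u (.exFr h φ) → ∃ w : Val Z N.carrier, w.IsConsolidation v' ∧
            u = h.consolidation w ∧ N.Sat w φ from this _ hfin fun _ h => h
  intro s hs
  induction s, hs using Set.Finite.induction_on with
  | empty => exact fun _ => ⟨W, v, hv, hiso, Val.refl_isConsolidation v, fun u hu => hu.elim⟩
  | @insert u s _ _ ih =>
    intro hsub
    obtain ⟨W', v', hv', hiso', hvv', hsol⟩ := ih fun u hu => hsub u (.inr hu)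
    by_cases hu : N.Sat u (.exFr h φ)
    · obtain ⟨W'', v'', hv'', hiso'', hvv'', w, hw, huw, hwφ⟩ :=
        exists_witness_fragmentation hX hd hN hv' hiso' ((hsub u (.inl rfl)).trans hvv') hu
      refine ⟨W'', v'', hv'', hiso'', hvv'.trans hvv'', ?_⟩
      rintro u' (rfl | hu') hsat
      · exact ⟨w, hw, huw, hwφ⟩
      · obtain ⟨w', hw', h'⟩ := hsol u' hu' hsat
        exact ⟨w', hw'.trans hvv'', h'⟩
    · refine ⟨W', v', hv', hiso', hvv', ?_⟩
      rintro u' (rfl | hu') hsat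
      · exact absurd hsat hu
      · exact hsol u' hu' hsat

theorem exists_generic_chain [Countable (Σ m, L.Relations m)] {W : Context} {v : Val W N.carrier}
    (hv : v ∈ N.adm W) (hiso : IsIsolated.{u, v, w} T (N.typeOf v)) :
    ∃ (A : ℕ → Context) (c : (i : ℕ) → Val (A i) N.carrier), (∀ i, c i ∈ N.adm (A i)) ∧
      (∀ i, IsIsolated.{u, v, w} T (N.typeOf (c i))) ∧
      (∀ i, (c i).IsConsolidation (c (i + 1))) ∧ v.IsConsolidation (c 0) ∧
      ∀ {Y Z : Context} (u : Val Y N.carrier), InSpan c u → ∀ (h : Val Y Z) (φ : Formula L Z),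
        N.Sat u (.exFr h φ) → ∃ w, InSpan c w ∧ u = h.consolidation w ∧ N.Sat w φ := by
  let State := {p : Σ W : Context, Val W N.carrier //
    p.2 ∈ N.adm p.1 ∧ IsIsolated.{u, v, w} T (N.typeOf p.2)}
  let Task := Σ Y Z : Context, Val Y Z × Formula L Z
  have : Nonempty Task := ⟨∅, ∅, Val.ofSurjective id Function.surjective_id, .bot⟩
  obtain ⟨e, he⟩ := exists_surjective_nat Task
  have hstep : ∀ (t : Task) (p : State), ∃ q : State, p.1.2.IsConsolidation q.1.2 ∧
      ∀ u : Val t.1 N.carrier, u.IsConsolidation p.1.2 → N.Sat u (.exFr t.2.2.1 t.2.2.2) →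
        ∃ w : Val t.2.1 N.carrier, w.IsConsolidation q.1.2 ∧
          u = t.2.2.1.consolidation w ∧ N.Sat w t.2.2.2 := by
    rintro ⟨Y, Z, h, φ⟩ ⟨⟨W, v⟩, hv, hiso⟩
    obtain ⟨W', v', hv', hiso', hvv', hsol⟩ :=
      exists_fragmentation_witnessing hX hd hN hv hiso h φ
    exact ⟨⟨⟨W', v'⟩, hv', hiso'⟩, hvv', hsol⟩
  choose next hnext hsol using hstep
  -- Stage `n` treats task number `n.unpair.1`, so each task recurs at arbitrarily late stages, in
  -- particular once a given `u` has become a consolidation of the current member.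
  let s : ℕ → State := Nat.rec ⟨⟨W, v⟩, hv, hiso⟩ fun n p => next (e n.unpair.1) p
  have hc : ∀ i, (s i).1.2.IsConsolidation (s (i + 1)).1.2 := fun i => hnext _ _
  refine ⟨fun i => (s i).1.1, fun i => (s i).1.2, fun i => (s i).2.1, fun i => (s i).2.2, hc,
    Val.refl_isConsolidation v, ?_⟩
  intro Y Z u hu h φ hsat
  obtain ⟨i, hi⟩ := hu.eventually hc
  obtain ⟨k, hk⟩ := he ⟨Y, Z, h, φ⟩
  have hs := hsol (e (Nat.pair k i).unpair.1) (s (Nat.pair k i))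
  rw [Nat.unpair_pair, hk] at hs
  obtain ⟨w, hw, huw⟩ := hs u (hi _ (Nat.right_le_pair k i)) hsat
  refine ⟨w, ⟨Nat.pair k i + 1, ?_⟩, huw⟩
  have : s (Nat.pair k i + 1) = next ⟨Y, Z, h, φ⟩ (s (Nat.pair k i)) := by
    change next (e (Nat.pair k i).unpair.1) _ = _
    rw [Nat.unpair_pair, hk]
  change w.IsConsolidation (s (Nat.pair k i + 1)).1.2
  rw [this]
  exact hw

end Chain

theorem exists_isAtomicModel [L.IsRelational] [Countable (Σ m, L.Relations m)]
    (hT : IsConsistent.{u, v, w} T) {X : ℕ → Context} (hX : ∀ n, (X n).card = n)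
    (hd : ∀ n, IsolatedDense.{u, v, w} T (X n)) :
    ∃ M : ProtoStructure.{u, v, w} L, IsAtomicModel T M := by
  obtain ⟨N₀, hN₀⟩ := hT
  obtain ⟨v₀, hv₀, -⟩ := id hN₀.2
  -- Density applied to a true formula in the context `{*}` provides the starting point of the
  -- chain.
  obtain ⟨N, hN, v, hv, -, hiso⟩ := exists_isIsolated (φ := Formula.bot.neg) hX hd hN₀ hv₀
    (by simp only [ProtoStructure.Sat, not_false_iff])
  obtain ⟨A, c, hcN, hciso, hc, hvc, hgen⟩ := exists_generic_chain hX hd hN hv hiso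
  have hstruct := spectrumStructure_isStructure hc hN.1 hcN hgen
  have hsat := fun {Y : Context} => spectrumStructure_sat_lift (Y := Y) hc hN.1 hcN hgen
  refine ⟨spectrumStructure N c hc,
    ⟨hstruct, spectrumStructure_isCompact hc, spectrumStructure_isOmega hc⟩, ⟨hstruct, ?_⟩, ?_⟩
  · obtain ⟨v', -, hv'T⟩ := hN.2
    have : Subsingleton starContext := by unfold starContext; infer_instance
    -- There is only one co-valuation in the context `{*}`, so the starting point `v` realizes `T`.
    obtain rfl := Val.eq_of_subsingleton v v'
    exact ⟨v.lift ⟨0, hvc⟩, ⟨v, _, rfl⟩, fun φ hφ => (hsat φ v _).2 (hv'T φ hφ)⟩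
  · rintro Y ⟨p, hp, _⟩ ⟨_, ⟨u, hu, rfl⟩, hpu⟩
    obtain rfl : p = N.typeOf u := ProtoStructure.eq_typeOf hp fun φ hφ =>
      (hsat φ u hu).1 (hpu φ hφ)
    obtain ⟨i, g, rfl⟩ := hu
    exact (hciso i).consolidation hN.1 (hcN i) g

end Theory
end Types

end CovLogic

theorem mainTheorem10 (L : FirstOrder.Language.{u, v}) [L.IsRelational]
    [Countable (Σ m, L.Relations m)] (T : CovLogic.Theory L)
    (hT : CovLogic.Theory.IsConsistent.{u, v, w} T)
    (X : ℕ → CovLogic.Context) (hX : ∀ n, (X n).card = n) :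
    ((∀ n, CovLogic.Theory.IsolatedDense.{u, v, w} T (X n)) →
      ∃ M : CovLogic.ProtoStructure.{u, v, w} L, CovLogic.Theory.IsAtomicModel T M) ∧
    (CovLogic.Theory.Decides.{u, v, w} T →
      ((∃ M : CovLogic.ProtoStructure.{u, v, w} L, CovLogic.Theory.IsAtomicModel T M) ↔
        ∀ n, CovLogic.Theory.IsolatedDense.{u, v, w} T (X n))) := by
  have h := fun hd => CovLogic.Theory.exists_isAtomicModel hT hX hd
  exact ⟨h, fun hdec => ⟨fun ⟨_, hM⟩ n => hM.isolatedDense hdec (X n), h⟩⟩
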